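/- Let $\ell^\infty$ be the Banach space of bounded real sequences $x=(x_n)_{n\in\mathbb{Z}}$ with the supremum norm, and let $U$ be the bilateral right shift on $\ell^\infty$, $(Ux)_n=x_{n-1}$. For $q(0)\in\ell^\infty$ let $q(t)=\mathrm{e}^{(U-I)t}q(0)$ be the solution of the serial pursuit equation $\dot q=(U-I)q$, that is, of $\dot q_n=q_{n-1}-q_n$ for all $n\in\mathbb{Z}$. There exist initial conditions $q(0)\in\ell^\infty$ such that $q_n(0)\in\{0,1\}$ for every $n\in\mathbb{Z}$ and such that, for all integers $m\ge 0$ and $k$ with $m^2\le k<m^2+m$, one has $q_{-k}(0)=1$ if $m$ is even and $q_{-k}(0)=0$ if $m$ is odd. For every such initial condition, whatever its values in $\{0,1\}$ at the remaining indices, $q_0(t)$ does not converge as $t\to\infty$. -/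

import Mathlib

open Filter Topology
open scoped ENNReal

noncomputable section

namespace CarChain

/-- The Banach space of bounded real sequences indexed by the integers, with the sup norm. -/
abbrev BddSeq : Type := lp (fun _ : ℤ => ℝ) ∞

/-- The bilateral right shift on bounded sequences, `(U x) n = x (n - 1)`, as a bounded operator. -/
def rightShift : BddSeq →L[ℝ] BddSeq :=
  LinearMap.mkContinuous
    { toFun := fun x => ⟨fun n => x (n - 1), by
        refine memℓp_infty ⟨‖x‖, ?_⟩
        rintro _ ⟨n, rfl⟩
        exact lp.norm_apply_le_norm ENNReal.top_ne_zero x (n - 1)⟩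
      map_add' := fun _ _ => rfl
      map_smul' := fun _ _ => rfl }
    1 (by
      intro x
      rw [one_mul]
      exact lp.norm_le_of_forall_le (norm_nonneg x)
        (fun n => lp.norm_apply_le_norm ENNReal.top_ne_zero x (n - 1)))

theorem rightShift_apply (x : BddSeq) (n : ℤ) : rightShift x n = x (n - 1) := rfl

/-- The solution `q(t) = exp ((U - I) t) q(0)` of the serial pursuit equation `q' = (U - I) q`, that
is, of `q_n' = q_{n-1} - q_n` for all integers `n`, with the initial condition `q₀`. -/
def pursuit (q₀ : BddSeq) (t : ℝ) : BddSeq :=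
  NormedSpace.exp (t • (rightShift - ContinuousLinearMap.id ℝ BddSeq)) q₀

theorem pursuit_zero (q₀ : BddSeq) : pursuit q₀ 0 = q₀ := by
  have h : (0 : ℝ) • (rightShift - ContinuousLinearMap.id ℝ BddSeq) = 0 :=
    zero_smul ℝ (rightShift - ContinuousLinearMap.id ℝ BddSeq)
  rw [pursuit, h, NormedSpace.exp_zero]
  rfl

theorem hasDerivAt_pursuit (q₀ : BddSeq) (t : ℝ) :
    HasDerivAt (pursuit q₀) (rightShift (pursuit q₀ t) - pursuit q₀ t) t := by
  have h := hasDerivAt_exp_smul_const' (𝕂 := ℝ)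
    (rightShift - ContinuousLinearMap.id ℝ BddSeq) t
  exact ((ContinuousLinearMap.apply ℝ BddSeq q₀).hasFDerivAt.comp_hasDerivAt t h)

/-- The initial conditions of the example: every car starts at `0` or at `1`; the cars `-k` with
`m² ≤ k < m² + m` start at `1` if `m` is even and at `0` if `m` is odd.  The remaining cars
are unconstrained (apart from starting at `0` or `1`). -/
structure IsAlternatingStart (q₀ : BddSeq) : Prop where
  zero_or_one : ∀ n : ℤ, q₀ n = 0 ∨ q₀ n = 1
  even_block : ∀ m k : ℕ, Even m → m ^ 2 ≤ k → k < m ^ 2 + m → q₀ (-(k : ℤ)) = 1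
  odd_block : ∀ m k : ℕ, Odd m → m ^ 2 ≤ k → k < m ^ 2 + m → q₀ (-(k : ℤ)) = 0

/-- The coordinates of `pursuit` satisfy the equations of serial pursuit. -/
theorem hasDerivAt_pursuit_apply (q₀ : BddSeq) (n : ℤ) (t : ℝ) :
    HasDerivAt (fun s => pursuit q₀ s n) (pursuit q₀ t (n - 1) - pursuit q₀ t n) t :=
  (lp.evalCLM ℝ (fun _ : ℤ => ℝ) ∞ n).hasFDerivAt.comp_hasDerivAt t (hasDerivAt_pursuit q₀ t)

end CarChain

end

/-!
Expanding `exp (t U)` shows that `q_n(t)` is the mean of `q_{n-k}(0)` over a Poisson variable `k`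
of mean `t`, a Borel mean of the sequence `a k = q_{n-k}(0)`.  Multiplying the Poisson weight of
rate `r` by `z ^ k` gives, up to a constant factor, the Poisson weight of rate `r z`.  Hence, if the
Borel means of `a` tend to `L`, taking `z = exp (s / √r)` shows that the moment generating function
at `s` of the law of `(k - r) / √r`, weighted by `a k`, tends to `L exp (s² / 2)`, and by Curtiss'
theorem the weighted law itself tends to `L` times the standard Gaussian.  So `a` has mean `L`
asymptotically on the windows `r ≤ k < r + c √r`: if `a` is equal to `α` on such windows for
arbitrarily large `r`, then `L = α`.  The blocks `m² ≤ k < m² + m` are windows with `c = 1`; the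
even ones force `L = 1` and the odd ones `L = 0`.
-/

namespace CarChain

open Asymptotics MeasureTheory ProbabilityTheory
open scoped NNReal BoundedContinuousFunction Nat

section Curtiss

variable {ι Ω : Type*} {𝓕 : Filter ι} [TopologicalSpace Ω]

/-- The truncation `min f M` of a nonnegative continuous function, as a bounded continuous
function. -/
noncomputable def truncate (f : C(Ω, ℝ)) (hf : ∀ x, 0 ≤ f x) (M : ℝ≥0) : Ω →ᵇ ℝ :=
  BoundedContinuousFunction.ofNormedAddCommGroup (fun x => min (f x) M) (by fun_prop) M fun x => by
    rw [Real.norm_of_nonneg (le_min (hf x) M.coe_nonneg)]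
    exact min_le_right _ _

theorem truncate_apply (f : C(Ω, ℝ)) (hf : ∀ x, 0 ≤ f x) (M : ℝ≥0) (x : Ω) :
    truncate f hf M x = min (f x) M := rfl

theorem truncate_nonneg (f : C(Ω, ℝ)) (hf : ∀ x, 0 ≤ f x) (M : ℝ≥0) (x : Ω) :
    0 ≤ truncate f hf M x :=
  le_min (hf x) M.coe_nonneg

theorem sub_truncate_le (f : C(Ω, ℝ)) (hf : ∀ x, 0 ≤ f x) {M : ℝ≥0} (hM : 0 < M) (x : Ω) :
    f x - truncate f hf M x ≤ f x ^ 2 / M := by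
  have hM' : (0 : ℝ) < M := hM
  rw [truncate_apply, le_div_iff₀ hM']
  rcases le_total (f x) M with h | h
  · rw [min_eq_left h]; nlinarith [sq_nonneg (f x)]
  · rw [min_eq_right h]; nlinarith [mul_nonneg hM'.le (sub_nonneg.2 h), sq_nonneg (f x - M)]

theorem tendsto_truncate (f : C(Ω, ℝ)) (hf : ∀ x, 0 ≤ f x) (x : Ω) :
    Tendsto (fun n : ℕ => truncate f hf n x) atTop (𝓝 (f x)) := by
  refine tendsto_const_nhds.congr' ?_
  filter_upwards [eventually_ge_atTop ⌈f x⌉₊] with n hn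
  exact (min_eq_left (by simpa using Nat.ceil_le.mp hn)).symm

variable [MeasurableSpace Ω] [OpensMeasurableSpace Ω]

theorem integrable_and_integral_le_of_tendsto [𝓕.NeBot] {ν : ι → FiniteMeasure Ω}
    {μ : FiniteMeasure Ω} (hν : Tendsto ν 𝓕 (𝓝 μ)) (f : C(Ω, ℝ)) (hf : ∀ x, 0 ≤ f x)
    (hint : ∀ i, Integrable f (ν i)) {C : ℝ} (hC : ∀ᶠ i in 𝓕, ∫ x, f x ∂(ν i) ≤ C) :
    Integrable f μ ∧ ∫ x, f x ∂μ ≤ C := by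
  have truncate_le (n : ℕ) : ∫ x, truncate f hf n x ∂μ ≤ C := by
    refine le_of_tendsto
      (FiniteMeasure.tendsto_iff_forall_integral_tendsto.mp hν (truncate f hf n)) ?_
    filter_upwards [hC] with i hi
    exact (integral_mono ((truncate f hf n).integrable _) (hint i)
      fun x => min_le_left _ _).trans hi
  have lintegral_le : ∫⁻ x, ENNReal.ofReal (f x) ∂μ ≤ ENNReal.ofReal C := by
    refine (lintegral_mono fun x =>
      (ENNReal.tendsto_ofReal (tendsto_truncate f hf x)).liminf_eq.ge).trans ?_
    refine (lintegral_liminf_le (u := (atTop : Filter ℕ)) fun n =>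
      (truncate f hf n).continuous.measurable.ennreal_ofReal).trans ?_
    refine liminf_le_of_frequently_le' (.of_forall fun n => ?_)
    rw [← ofReal_integral_eq_lintegral_ofReal ((truncate f hf n).integrable _)
      (.of_forall (truncate_nonneg f hf n))]
    exact ENNReal.ofReal_le_ofReal (truncate_le n)
  have hf_meas : AEStronglyMeasurable f (μ : Measure Ω) :=
    f.continuous.measurable.aestronglyMeasurable
  refine ⟨⟨hf_meas, ?_⟩, ?_⟩
  · rw [hasFiniteIntegral_iff_ofReal (.of_forall hf)]
    exact lintegral_le.trans_lt ENNReal.ofReal_lt_top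
  · have hC₀ : 0 ≤ C := (integral_nonneg (truncate_nonneg f hf (0 : ℕ))).trans (truncate_le 0)
    rw [integral_eq_lintegral_of_nonneg_ae (.of_forall hf) hf_meas]
    exact ENNReal.toReal_le_of_le_ofReal hC₀ lintegral_le

theorem abs_integral_sub_integral_truncate_le (μ : FiniteMeasure Ω) (f : C(Ω, ℝ))
    (hf : ∀ x, 0 ≤ f x) (hint : Integrable (fun x => f x ^ 2) μ) {M : ℝ≥0} (hM : 0 < M) :
    |∫ x, f x ∂μ - ∫ x, truncate f hf M x ∂μ| ≤ (∫ x, f x ^ 2 ∂μ) / M := by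
  have hf_int : Integrable f μ :=
    ((memLp_two_iff_integrable_sq f.continuous.measurable.aestronglyMeasurable).2 hint).integrable
      one_le_two
  have htrunc_int := (truncate f hf M).integrable (μ : Measure Ω)
  rw [← integral_sub hf_int htrunc_int, ← integral_div, abs_of_nonneg]
  · exact integral_mono (hf_int.sub htrunc_int) (hint.div_const _) (sub_truncate_le f hf hM)
  · exact integral_nonneg fun x => sub_nonneg.2 (min_le_left _ _)

theorem tendsto_integral_of_tendsto_of_integral_sq_le [𝓕.NeBot] {ν : ι → FiniteMeasure Ω}
    {μ : FiniteMeasure Ω} (hν : Tendsto ν 𝓕 (𝓝 μ)) (f : C(Ω, ℝ)) (hf : ∀ x, 0 ≤ f x)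
    (hint : ∀ i, Integrable (fun x => f x ^ 2) (ν i)) {C : ℝ}
    (hC : ∀ᶠ i in 𝓕, ∫ x, f x ^ 2 ∂(ν i) ≤ C) :
    Tendsto (fun i => ∫ x, f x ∂(ν i)) 𝓕 (𝓝 (∫ x, f x ∂μ)) := by
  obtain ⟨hμ_int, hμC⟩ := integrable_and_integral_le_of_tendsto hν (f ^ 2)
    (fun x => sq_nonneg (f x)) hint hC
  refine Metric.tendsto_nhds.2 fun ε hε => ?_
  obtain ⟨n, hn⟩ := exists_nat_gt (max (C / (ε / 3)) 0)
  have hn₀ : (0 : ℝ) < n := (le_max_right _ _).trans_lt hn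
  have hnC : C / n < ε / 3 := by
    rw [div_lt_iff₀ hn₀, mul_comm, ← div_lt_iff₀ (by positivity)]
    exact (le_max_left _ _).trans_lt hn
  have truncate_near (κ : FiniteMeasure Ω) (hκ : Integrable (fun x => f x ^ 2) κ)
      (hκC : ∫ x, f x ^ 2 ∂κ ≤ C) : |∫ x, f x ∂κ - ∫ x, truncate f hf n x ∂κ| < ε / 3 := by
    refine (abs_integral_sub_integral_truncate_le κ f hf hκ (M := n) (mod_cast hn₀)).trans_lt
      (lt_of_le_of_lt ?_ hnC)
    simp only [NNReal.coe_natCast]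
    gcongr
  filter_upwards [hC, Metric.tendsto_nhds.1
    (FiniteMeasure.tendsto_iff_forall_integral_tendsto.mp hν (truncate f hf n)) (ε / 3)
    (by positivity)] with i hi hi'
  have h₁ := abs_lt.1 (truncate_near (ν i) (hint i) hi)
  have h₂ := abs_lt.1 (truncate_near μ hμ_int hμC)
  rw [Real.dist_eq, abs_lt] at hi' ⊢
  constructor <;> linarith [h₁.1, h₁.2, h₂.1, h₂.2, hi'.1, hi'.2]

theorem tendsto_mgf_of_tendsto [𝓕.NeBot] {ν : ι → FiniteMeasure ℝ} {μ : FiniteMeasure ℝ}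
    (hν : Tendsto ν 𝓕 (𝓝 μ)) {t : ℝ}
    (hint : ∀ i, Integrable (fun x => Real.exp (2 * t * x)) (ν i)) {C : ℝ}
    (hC : ∀ᶠ i in 𝓕, mgf id (ν i) (2 * t) ≤ C) :
    Tendsto (fun i => mgf id (ν i) t) 𝓕 (𝓝 (mgf id μ t)) := by
  have exp_sq (x : ℝ) : Real.exp (t * x) ^ 2 = Real.exp (2 * t * x) := by
    rw [← Real.exp_nat_mul]; ring_nf
  refine tendsto_integral_of_tendsto_of_integral_sq_le hν
    ⟨fun x => Real.exp (t * x), by fun_prop⟩ (fun x => (Real.exp_pos _).le) ?_ (C := C) ?_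
  · simpa only [ContinuousMap.coe_mk, exp_sq] using hint
  · simpa only [ContinuousMap.coe_mk, exp_sq, mgf, id] using hC

theorem measureReal_compl_Icc_le (ν : Measure ℝ) [IsFiniteMeasure ν]
    (hint : ∀ t : ℝ, Integrable (fun x => Real.exp (t * x)) ν) (a : ℝ) :
    ν.real (Set.Icc (-a) a)ᶜ ≤ Real.exp (-a) * (mgf id ν 1 + mgf id ν (-1)) := by
  have compl_subset : (Set.Icc (-a) a)ᶜ ⊆ {x | a ≤ id x} ∪ {x | id x ≤ -a} := by
    intro x hx
    simp only [Set.mem_compl_iff, Set.mem_Icc, not_and_or, not_le] at hx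
    exact hx.symm.imp le_of_lt le_of_lt
  have upper := measure_ge_le_exp_mul_mgf (X := id) a zero_le_one (hint 1)
  have lower := measure_le_le_exp_mul_mgf (X := id) (-a) (neg_nonpos.2 zero_le_one) (hint (-1))
  calc ν.real (Set.Icc (-a) a)ᶜ
      ≤ ν.real {x | a ≤ id x} + ν.real {x | id x ≤ -a} :=
        (measureReal_mono compl_subset).trans (measureReal_union_le _ _)
    _ ≤ Real.exp (-1 * a) * mgf id ν 1 + Real.exp (- -1 * -a) * mgf id ν (-1) :=
        add_le_add upper lower
    _ = Real.exp (-a) * (mgf id ν 1 + mgf id ν (-1)) := by ring_nf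

theorem ext_of_mgf_id_eq {μ ν : Measure ℝ} [IsFiniteMeasure μ] [IsFiniteMeasure ν]
    (hint : ∀ t : ℝ, Integrable (fun x => Real.exp (t * x)) μ) (h : mgf id μ = mgf id ν) :
    μ = ν := by
  have mass_eq : μ.real Set.univ = ν.real Set.univ := by
    rw [← mgf_zero' (X := id) (μ := μ), ← mgf_zero' (X := id) (μ := ν), h]
  have eq_zero_iff : μ = 0 ↔ ν = 0 := by
    rw [← Measure.measure_univ_eq_zero, ← Measure.measure_univ_eq_zero,
      ← measureReal_eq_zero_iff, ← measureReal_eq_zero_iff, mass_eq]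
  have strip_eq_univ : integrableExpSet id μ = Set.univ := Set.eq_univ_of_forall hint
  refine Measure.ext_of_complexMGF_id_eq (funext fun z => eqOn_complexMGF_of_mgf' h eq_zero_iff ?_)
  simp [strip_eq_univ]

theorem exists_isCompact_of_mgf_le (C : ℝ≥0) :
    ∃ K : Set (FiniteMeasure ℝ), IsCompact K ∧ ∀ ν : FiniteMeasure ℝ,
      (∀ t : ℝ, Integrable (fun x => Real.exp (t * x)) ν) → mgf id ν 0 ≤ C →
      mgf id ν 1 + mgf id ν (-1) ≤ C → ν ∈ K := by
  have tail_tendsto : Tendsto (fun n : ℕ => Real.toNNReal (Real.exp (-n)) * C) atTop (𝓝 0) := by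
    have h := (continuous_real_toNNReal.tendsto 0).comp
      (Real.tendsto_exp_neg_atTop_nhds_zero.comp tendsto_natCast_atTop_atTop)
    simpa using h.mul_const C
  refine ⟨_, isCompact_setOfPred_finiteMeasure_mass_le_compl_isCompact_le C tail_tendsto
    (K := fun n => Set.Icc (-n : ℝ) n) (fun n => isCompact_Icc) (.inl inferInstance),
    fun ν hint h₀ h₁ => ⟨?_, fun n => ?_⟩⟩
  · rw [mgf_zero'] at h₀
    exact h₀
  · rw [← NNReal.coe_le_coe]
    push_cast
    rw [Real.coe_toNNReal _ (Real.exp_pos _).le]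
    exact (measureReal_compl_Icc_le ν hint n).trans (by gcongr)

/-- **Curtiss' theorem**. -/
theorem tendsto_of_tendsto_mgf {ν : ι → FiniteMeasure ℝ} {μ : FiniteMeasure ℝ}
    (hν : ∀ i (t : ℝ), Integrable (fun x => Real.exp (t * x)) (ν i))
    (hμ : ∀ t : ℝ, Integrable (fun x => Real.exp (t * x)) μ)
    (h : ∀ t, Tendsto (fun i => mgf id (ν i) t) 𝓕 (𝓝 (mgf id μ t))) :
    Tendsto ν 𝓕 (𝓝 μ) := by
  refine (tendsto_iff_ultrafilter _ _ _).2 fun U hU => ?_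
  have mgf_bounded (t : ℝ) : ∀ᶠ i in (U : Filter ι), mgf id (ν i) t ≤ mgf id μ t + 1 :=
    (((h t).mono_left hU).eventually_lt_const (lt_add_one _)).mono fun _ => le_of_lt
  obtain ⟨K, hK, hνK⟩ := exists_isCompact_of_mgf_le
    (Real.toNNReal (mgf id μ 0 + mgf id μ 1 + mgf id μ (-1) + 2))
  obtain ⟨κ, -, hκ : Tendsto ν U (𝓝 κ)⟩ := hK.ultrafilter_le_nhds (U.map ν) <| by
    rw [le_principal_iff, Ultrafilter.mem_coe, Ultrafilter.mem_map]
    filter_upwards [mgf_bounded 0, mgf_bounded 1, mgf_bounded (-1)] with i h₀ h₁ h₂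
    have hpos (t : ℝ) : 0 ≤ mgf id (μ : Measure ℝ) t := mgf_nonneg
    refine hνK _ (hν i) ?_ ?_ <;> refine le_trans ?_ (Real.le_coe_toNNReal _) <;>
      linarith [hpos 0, hpos 1, hpos (-1)]
  suffices (μ : Measure ℝ) = κ by rwa [← Subtype.ext this] at hκ
  refine ext_of_mgf_id_eq hμ (funext fun t => ?_)
  exact tendsto_nhds_unique ((h t).mono_left hU)
    (tendsto_mgf_of_tendsto hκ (fun i => hν i (2 * t)) (mgf_bounded (2 * t)))

end Curtiss

section BorelMean

theorem tendsto_sq_mul_exp_div_sub_one (t : ℝ) :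
    Tendsto (fun s : ℝ => s ^ 2 * (Real.exp (t / s) - 1) - t * s) atTop (𝓝 (t ^ 2 / 2)) := by
  have remainder_isLittleO := (isBigO_refl (fun s : ℝ => s ^ 2) atTop).mul_isLittleO
    ((Real.exp_sub_sum_range_succ_isLittleO_pow 2).comp_tendsto
      (tendsto_const_nhds.div_atTop tendsto_id : Tendsto (fun s : ℝ => t / s) atTop (𝓝 0)))
  have scale_isBigO : (fun s : ℝ => s ^ 2 * (t / s) ^ 2) =O[atTop] fun _ => (1 : ℝ) := by
    refine (isBigO_const_const (t ^ 2) one_ne_zero atTop).congr' ?_ .rfl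
    filter_upwards [eventually_ne_atTop 0] with s hs
    field_simp
  have remainder_tendsto :=
    (isLittleO_one_iff ℝ).1 (remainder_isLittleO.trans_isBigO scale_isBigO)
  refine (zero_add (t ^ 2 / 2) ▸ remainder_tendsto.add_const (t ^ 2 / 2)).congr' ?_
  filter_upwards [eventually_ne_atTop 0] with s hs
  simp only [Function.comp_apply, Finset.sum_range_succ, Finset.sum_range_zero, Nat.factorial]
  field_simp
  ring

theorem tendsto_mul_exp_div_sqrt_atTop (t : ℝ) :
    Tendsto (fun r : ℝ≥0 => r * Real.toNNReal (Real.exp (t / √r))) atTop atTop := by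
  have sqrt_tendsto : Tendsto (fun r : ℝ≥0 => √(r : ℝ)) atTop atTop :=
    Real.tendsto_sqrt_atTop.comp (NNReal.tendsto_coe_atTop.2 tendsto_id)
  have factor_tendsto :
      Tendsto (fun r : ℝ≥0 => Real.toNNReal (Real.exp (t / √r))) atTop (𝓝 1) := by
    have h := (continuous_real_toNNReal.comp Real.continuous_exp).tendsto 0 |>.comp
      (tendsto_const_nhds.div_atTop sqrt_tendsto : Tendsto (fun r : ℝ≥0 => t / √r) _ (𝓝 0))
    simpa [Function.comp_def] using h
  exact tendsto_id.atTop_mul_pos zero_lt_one factor_tendsto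

theorem integrable_mul_pow_poissonMeasure {a : ℕ → ℝ} {r z : ℝ≥0}
    (ha : Integrable a Po(r * z)) : Integrable (fun k => a k * (z : ℝ) ^ k) Po(r) := by
  rw [integrable_poissonMeasure_iff] at ha ⊢
  refine (ha.mul_left (Real.exp (r * z - r))).congr fun k => ?_
  have h : Real.exp (-r) = Real.exp (r * z - r) * Real.exp (-(r * z : ℝ≥0)) := by
    rw [← Real.exp_add]; push_cast; ring_nf
  rw [h, norm_mul, norm_pow, NNReal.norm_eq]
  push_cast
  ring

theorem integral_mul_pow_poissonMeasure (a : ℕ → ℝ) (r z : ℝ≥0) :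
    ∫ k, a k * (z : ℝ) ^ k ∂Po(r) = Real.exp (r * (z - 1)) * ∫ k, a k ∂Po(r * z) := by
  rw [integral_poissonMeasure, integral_poissonMeasure, ← tsum_mul_left]
  refine tsum_congr fun k => ?_
  have h : Real.exp (-r) = Real.exp (r * (z - 1)) * Real.exp (-(r * z : ℝ≥0)) := by
    rw [← Real.exp_add]; push_cast; ring_nf
  rw [h]
  push_cast [smul_eq_mul]
  ring

/-- The law of `(k - r) / √r` for a Poisson variable `k` of mean `r`, reweighted by `a k`.  Its
total mass is the Borel mean of `a` at `r`. -/
noncomputable def weightedPoisson (a : ℕ → ℝ≥0) (r : ℝ≥0) : Measure ℝ :=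
  (Po(r).withDensity fun k => a k).map fun k : ℕ => (k - r) / √r

variable {a : ℕ → ℝ≥0}

theorem isFiniteMeasure_weightedPoisson {r : ℝ≥0} (ha : Integrable (fun k => (a k : ℝ)) Po(r)) :
    IsFiniteMeasure (weightedPoisson a r) := by
  have := isFiniteMeasure_withDensity_ofReal ha.2
  simp only [ENNReal.ofReal_coe_nnreal] at this
  rw [weightedPoisson]
  infer_instance

theorem integral_weightedPoisson (a : ℕ → ℝ≥0) (r : ℝ≥0) {f : ℝ → ℝ} (hf : Measurable f) :
    ∫ x, f x ∂weightedPoisson a r = ∫ k, a k * f ((k - r) / √r) ∂Po(r) := by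
  rw [weightedPoisson, integral_map .of_discrete hf.aestronglyMeasurable,
    integral_withDensity_eq_integral_smul .of_discrete]
  rfl

theorem integrable_weightedPoisson_iff {r : ℝ≥0} {f : ℝ → ℝ} (hf : Measurable f) :
    Integrable f (weightedPoisson a r) ↔ Integrable (fun k => a k * f ((k - r) / √r)) Po(r) := by
  rw [weightedPoisson, integrable_map_measure hf.aestronglyMeasurable .of_discrete,
    integrable_withDensity_iff_integrable_smul .of_discrete]
  rfl

theorem exp_mul_standardize (r : ℝ≥0) (t : ℝ) (k : ℕ) :
    Real.exp (t * ((k - r) / √r)) =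
      Real.exp (-(t * √r)) * (Real.toNNReal (Real.exp (t / √r)) : ℝ) ^ k := by
  rw [Real.coe_toNNReal _ (Real.exp_pos _).le, ← Real.exp_nat_mul, ← Real.exp_add, sub_div,
    Real.div_sqrt]
  ring_nf

theorem integrable_exp_weightedPoisson (ha : ∀ r, Integrable (fun k => (a k : ℝ)) Po(r))
    (r : ℝ≥0) (t : ℝ) : Integrable (fun x => Real.exp (t * x)) (weightedPoisson a r) := by
  rw [integrable_weightedPoisson_iff (by fun_prop)]
  refine ((integrable_mul_pow_poissonMeasure (ha (r * Real.toNNReal (Real.exp (t / √r))))).const_mul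
    (Real.exp (-(t * √r)))).congr (.of_forall fun k => ?_)
  simp only [exp_mul_standardize]
  ring

theorem mgf_weightedPoisson (a : ℕ → ℝ≥0) (r : ℝ≥0) (t : ℝ) :
    mgf id (weightedPoisson a r) t =
      Real.exp (√r ^ 2 * (Real.exp (t / √r) - 1) - t * √r) *
        ∫ k, (a k : ℝ) ∂Po(r * Real.toNNReal (Real.exp (t / √r))) := by
  have integral_exp : mgf id (weightedPoisson a r) t =
      ∫ k, a k * Real.exp (t * ((k - r) / √r)) ∂Po(r) :=
    integral_weightedPoisson a r (f := fun x => Real.exp (t * x)) (by fun_prop)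
  simp only [integral_exp, exp_mul_standardize, mul_left_comm (a _ : ℝ)]
  rw [integral_const_mul, integral_mul_pow_poissonMeasure, ← mul_assoc, ← Real.exp_add,
    Real.coe_toNNReal _ (Real.exp_pos _).le, Real.sq_sqrt r.coe_nonneg]
  ring_nf

theorem tendsto_mgf_weightedPoisson {L : ℝ}
    (hL : Tendsto (fun r : ℝ≥0 => ∫ k, (a k : ℝ) ∂Po(r)) atTop (𝓝 L)) (t : ℝ) :
    Tendsto (fun r => mgf id (weightedPoisson a r) t) atTop (𝓝 (Real.exp (t ^ 2 / 2) * L)) := by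
  simp only [mgf_weightedPoisson]
  have sqrt_tendsto : Tendsto (fun r : ℝ≥0 => √(r : ℝ)) atTop atTop :=
    Real.tendsto_sqrt_atTop.comp (NNReal.tendsto_coe_atTop.2 tendsto_id)
  exact ((Real.continuous_exp.tendsto _).comp
    ((tendsto_sq_mul_exp_div_sub_one t).comp sqrt_tendsto)).mul
      (hL.comp (tendsto_mul_exp_div_sqrt_atTop t))

theorem tendsto_integral_standardize_of_nonneg
    (ha : ∀ r, Integrable (fun k => (a k : ℝ)) Po(r)) {L : ℝ}
    (hL : Tendsto (fun r : ℝ≥0 => ∫ k, (a k : ℝ) ∂Po(r)) atTop (𝓝 L)) (f : ℝ →ᵇ ℝ) :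
    Tendsto (fun r : ℝ≥0 => ∫ k, a k * f ((k - r) / √r) ∂Po(r)) atTop
      (𝓝 (L * ∫ x, f x ∂gaussianReal 0 1)) := by
  lift L to ℝ≥0 using ge_of_tendsto' hL fun r => integral_nonneg fun k => (a k).coe_nonneg
  let ν (r : ℝ≥0) : FiniteMeasure ℝ :=
    ⟨weightedPoisson a r, isFiniteMeasure_weightedPoisson (ha r)⟩
  let γ : FiniteMeasure ℝ := L • ⟨gaussianReal 0 1, inferInstance⟩
  have coe_γ : (γ : Measure ℝ) = L • gaussianReal 0 1 := rfl
  have mgf_γ (t : ℝ) : mgf id γ t = Real.exp (t ^ 2 / 2) * L := by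
    have h : mgf id (gaussianReal 0 1) t = Real.exp (t ^ 2 / 2) := by
      simp [mgf_id_gaussianReal]
    rw [coe_γ, mgf, integral_smul_nnreal_measure, ← mgf, h, NNReal.smul_def, smul_eq_mul, mul_comm]
  have ν_tendsto : Tendsto ν atTop (𝓝 γ) :=
    tendsto_of_tendsto_mgf (fun r t => integrable_exp_weightedPoisson ha r t)
      (fun t => coe_γ ▸ (integrable_exp_mul_gaussianReal t).smul_measure_nnreal)
      (fun t => mgf_γ t ▸ tendsto_mgf_weightedPoisson hL t)
  have integral_tendsto := FiniteMeasure.tendsto_iff_forall_integral_tendsto.mp ν_tendsto f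
  rw [coe_γ, integral_smul_nnreal_measure] at integral_tendsto
  exact integral_tendsto.congr fun r => integral_weightedPoisson a r f.continuous.measurable

theorem integrable_mul_comp_standardize {a : ℕ → ℝ} {r : ℝ≥0} (ha : Integrable a Po(r))
    (f : ℝ →ᵇ ℝ) : Integrable (fun k : ℕ => a k * f ((k - r) / √r)) Po(r) :=
  ha.mul_bdd (c := ‖f‖) .of_discrete (.of_forall fun _ => f.norm_coe_le_norm _)

theorem tendsto_integral_standardize {a : ℕ → ℝ} (ha : ∀ r, Integrable a Po(r)) {C : ℝ}
    (hC : ∀ k, C ≤ a k) {L : ℝ} (hL : Tendsto (fun r : ℝ≥0 => ∫ k, a k ∂Po(r)) atTop (𝓝 L))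
    (f : ℝ →ᵇ ℝ) :
    Tendsto (fun r : ℝ≥0 => ∫ k, a k * f ((k - r) / √r) ∂Po(r)) atTop
      (𝓝 (L * ∫ x, f x ∂gaussianReal 0 1)) := by
  obtain ⟨b, b_eq⟩ : ∃ b : ℕ → ℝ≥0, ∀ k, (b k : ℝ) = a k - C :=
    ⟨fun k => ⟨a k - C, sub_nonneg.2 (hC k)⟩, fun _ => rfl⟩
  have hb (r : ℝ≥0) : Integrable (fun k => (b k : ℝ)) Po(r) :=
    ((ha r).sub (integrable_const C)).congr (.of_forall fun k => (b_eq k).symm)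
  have b_mean : Tendsto (fun r : ℝ≥0 => ∫ k, (b k : ℝ) ∂Po(r)) atTop (𝓝 (L - C)) := by
    refine (hL.sub_const C).congr fun r => ?_
    simp only [b_eq]
    rw [integral_sub (ha r) (integrable_const C), integral_const, probReal_univ, one_smul]
  have b_tendsto := tendsto_integral_standardize_of_nonneg hb b_mean f
  have unweighted_tendsto : Tendsto (fun r : ℝ≥0 => ∫ k : ℕ, f ((k - r) / √r) ∂Po(r)) atTop
      (𝓝 (∫ x, f x ∂gaussianReal 0 1)) := by
    simpa using tendsto_integral_standardize_of_nonneg (a := fun _ => 1) (L := 1)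
      (fun r => integrable_const 1) (by simp) f
  have unweighted_integrable (r : ℝ≥0) : Integrable (fun k : ℕ => f ((k - r) / √r)) Po(r) := by
    simpa using integrable_mul_comp_standardize (integrable_const (1 : ℝ)) f
  refine (sub_add_cancel L C ▸ add_mul (L - C) C (∫ x, f x ∂gaussianReal 0 1) ▸
    b_tendsto.add (unweighted_tendsto.const_mul C)).congr fun r => ?_
  rw [← integral_const_mul, ← integral_add (integrable_mul_comp_standardize (hb r) f)
    ((unweighted_integrable r).const_mul C)]
  refine integral_congr_ae (.of_forall fun k => ?_)
  simp only [b_eq]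
  ring

theorem exists_boundedContinuous_support_Ioo_integral_gaussianReal_pos {c : ℝ} (hc : 0 < c) :
    ∃ f : ℝ →ᵇ ℝ, Function.support f = Set.Ioo 0 c ∧ 0 < ∫ x, f x ∂gaussianReal 0 1 := by
  let bump : ContDiffBump (c / 2) := ⟨c / 4, c / 2, by positivity, by linarith⟩
  let f : ℝ →ᵇ ℝ := BoundedContinuousFunction.ofNormedAddCommGroup bump bump.continuous 1
    fun x => by rw [Real.norm_of_nonneg bump.nonneg]; exact bump.le_one
  have f_support : Function.support f = Set.Ioo 0 c := by
    refine bump.support_eq.trans ?_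
    rw [Real.ball_eq_Ioo]
    simp [bump]
  refine ⟨f, f_support, ?_⟩
  rw [integral_pos_iff_support_of_nonneg (f := f) (fun x => bump.nonneg' x) (f.integrable _),
    f_support]
  refine pos_iff_ne_zero.2 fun h => (((Measure.measure_Ioo_pos volume).2 hc).ne' ?_ : False)
  exact gaussianReal_absolutelyContinuous' 0 one_ne_zero h

theorem eq_of_frequently_eq_on_window {a : ℕ → ℝ} (ha : ∀ r, Integrable a Po(r)) {C : ℝ}
    (hC : ∀ k, C ≤ a k) {L : ℝ} (hL : Tendsto (fun r : ℝ≥0 => ∫ k, a k ∂Po(r)) atTop (𝓝 L))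
    {c : ℝ} (hc : 0 < c) {α : ℝ}
    (hα : ∃ᶠ r : ℝ≥0 in atTop, ∀ k : ℕ, (r : ℝ) ≤ k → k < r + c * √r → a k = α) : L = α := by
  obtain ⟨f, f_support, f_pos⟩ := exists_boundedContinuous_support_Ioo_integral_gaussianReal_pos hc
  have shifted_tendsto : Tendsto (fun r : ℝ≥0 => ∫ k, (a k - α) * f ((k - r) / √r) ∂Po(r)) atTop
      (𝓝 ((L - α) * ∫ x, f x ∂gaussianReal 0 1)) := by
    refine tendsto_integral_standardize (a := fun k => a k - α)
      (fun r => (ha r).sub (integrable_const α)) (fun k => sub_le_sub_right (hC k) α)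
      ((hL.sub_const α).congr fun r => ?_) f
    rw [integral_sub (ha r) (integrable_const α), integral_const, probReal_univ, one_smul]
  have frequently_zero :
      ∃ᶠ r : ℝ≥0 in atTop, ∫ k, (a k - α) * f ((k - r) / √r) ∂Po(r) = 0 := by
    refine hα.mono fun r hr => integral_eq_zero_of_ae (.of_forall fun k => ?_)
    by_cases hx : (k - r) / √r ∈ Set.Ioo 0 c
    · have sqrt_pos : 0 < √(r : ℝ) :=
        (Real.sqrt_nonneg _).lt_of_ne fun h => by simp [← h] at hx
      have lower := (div_pos_iff_of_pos_right sqrt_pos).1 hx.1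
      have upper := (div_lt_iff₀ sqrt_pos).1 hx.2
      simp [hr k (by linarith) (by linarith)]
    · simp [Function.notMem_support.1 (f_support ▸ hx)]
  have limit_eq_zero : (L - α) * ∫ x, f x ∂gaussianReal 0 1 = 0 :=
    (isClosed_singleton.mem_of_frequently_of_tendsto frequently_zero shifted_tendsto :)
  exact sub_eq_zero.1 ((mul_eq_zero.1 limit_eq_zero).resolve_right f_pos.ne')

end BorelMean

section Pursuit

theorem rightShift_pow_apply (k : ℕ) (x : BddSeq) (n : ℤ) : (rightShift ^ k) x n = x (n - k) := by
  induction k generalizing n with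
  | zero => simp
  | succ k ih =>
    rw [pow_succ', mul_apply_eq_comp, rightShift_apply, ih, sub_sub, Nat.cast_succ,
      add_comm]

theorem hasSum_exp_smul_sub_one {A : Type*} [NormedRing A] [NormedAlgebra ℝ A] [CompleteSpace A]
    (x : A) (t : ℝ) :
    HasSum (fun k : ℕ => (Real.exp (-t) * t ^ k / k !) • x ^ k)
      (NormedSpace.exp (t • (x - 1))) := by
  let _ : NormedAlgebra ℚ A := NormedAlgebra.restrictScalars ℚ ℝ A
  have exponent_eq : t • (x - 1) = algebraMap ℝ A (-t) + t • x := by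
    rw [Algebra.algebraMap_eq_smul_one, smul_sub, neg_smul]
    abel
  have exp_eq : NormedSpace.exp (t • (x - 1)) = Real.exp (-t) • NormedSpace.exp (t • x) := by
    rw [exponent_eq, NormedSpace.exp_add_of_commute (Algebra.commutes _ _),
      ← NormedSpace.algebraMap_exp_comm, congrFun Real.exp_eq_exp_ℝ (-t), ← Algebra.smul_def]
  rw [exp_eq]
  refine ((NormedSpace.exp_series_hasSum_exp' (𝕂 := ℝ) (t • x)).const_smul
    (Real.exp (-t))).congr_fun fun k => ?_
  rw [smul_pow, smul_smul, smul_smul]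
  congr 1
  ring

theorem integrable_apply_sub_poissonMeasure (q₀ : BddSeq) (n : ℤ) (r : ℝ≥0) :
    Integrable (fun k : ℕ => q₀ (n - k)) Po(r) :=
  .of_bound .of_discrete ‖q₀‖
    (.of_forall fun k => lp.norm_apply_le_norm ENNReal.top_ne_zero q₀ (n - k))

theorem pursuit_apply_eq_integral_poissonMeasure (q₀ : BddSeq) (n : ℤ) (r : ℝ≥0) :
    pursuit q₀ r n = ∫ k : ℕ, q₀ (n - k) ∂Po(r) := by
  have pursuit_hasSum := ((lp.evalCLM ℝ (fun _ : ℤ => ℝ) ∞ n).comp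
    (ContinuousLinearMap.apply ℝ BddSeq q₀)).hasSum (hasSum_exp_smul_sub_one rightShift r)
  refine (pursuit_hasSum.congr_fun fun k => ?_).unique
    (hasSum_integral_poissonMeasure (integrable_apply_sub_poissonMeasure q₀ n r))
  rw [← rightShift_pow_apply]
  rfl

theorem eq_of_tendsto_pursuit_of_frequently_eq {q₀ : BddSeq} {n : ℤ} {L : ℝ}
    (hL : Tendsto (fun t => pursuit q₀ t n) atTop (𝓝 L)) {c : ℝ} (hc : 0 < c) {α : ℝ}
    (hα : ∃ᶠ r : ℝ in atTop, ∀ k : ℕ, r ≤ k → k < r + c * √r → q₀ (n - k) = α) : L = α := by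
  refine eq_of_frequently_eq_on_window (a := fun k => q₀ (n - k))
    (integrable_apply_sub_poissonMeasure q₀ n) (C := -‖q₀‖)
    (fun k => (abs_le.1 (lp.norm_apply_le_norm ENNReal.top_ne_zero q₀ (n - k))).1) ?_ hc ?_
  · exact (hL.comp (NNReal.tendsto_coe_atTop.2 tendsto_id)).congr fun r =>
      pursuit_apply_eq_integral_poissonMeasure q₀ n r
  · rwa [← NNReal.map_coe_atTop] at hα

theorem exists_isAlternatingStart : ∃ q₀ : BddSeq, IsAlternatingStart q₀ := by
  have sqrt_eq (m k : ℕ) (hmk : m ^ 2 ≤ k) (hkm : k < m ^ 2 + m) :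
      Nat.sqrt (-(k : ℤ)).natAbs = m := by
    rw [Int.natAbs_neg, Int.natAbs_natCast, eq_comm, Nat.eq_sqrt']
    exact ⟨hmk, by nlinarith⟩
  let f (n : ℤ) : ℝ := if Even (Nat.sqrt n.natAbs) then 1 else 0
  have f_zero_or_one (n : ℤ) : f n = 0 ∨ f n = 1 := (ite_eq_or_eq _ _ _).symm
  have f_mem : Memℓp f ∞ := by
    refine memℓp_infty ⟨1, ?_⟩
    rintro _ ⟨n, rfl⟩
    rcases f_zero_or_one n with h | h <;> simp [h]
  refine ⟨⟨f, f_mem⟩, f_zero_or_one, fun m k hm hmk hkm => ?_, fun m k hm hmk hkm => ?_⟩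
  · exact if_pos (by rwa [sqrt_eq m k hmk hkm])
  · exact if_neg (by rwa [sqrt_eq m k hmk hkm, Nat.not_even_iff_odd])

theorem frequently_window_of_frequently_block {a : ℕ → ℝ} {α : ℝ} {p : ℕ → Prop}
    (hp : ∃ᶠ m in atTop, p m)
    (h : ∀ m k : ℕ, p m → m ^ 2 ≤ k → k < m ^ 2 + m → a k = α) :
    ∃ᶠ r : ℝ in atTop, ∀ k : ℕ, r ≤ k → k < r + 1 * √r → a k = α := by
  have sq_tendsto : Tendsto (fun m : ℕ => (m : ℝ) ^ 2) atTop atTop :=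
    (tendsto_pow_atTop two_ne_zero).comp tendsto_natCast_atTop_atTop
  refine sq_tendsto.frequently (hp.mono fun m hm k hmk hkm => h m k hm ?_ ?_)
  · exact_mod_cast hmk
  · rw [Real.sqrt_sq m.cast_nonneg, one_mul] at hkm
    exact_mod_cast hkm

theorem IsAlternatingStart.frequently_eq_one {q₀ : BddSeq} (hq : IsAlternatingStart q₀) :
    ∃ᶠ r : ℝ in atTop, ∀ k : ℕ, r ≤ k → k < r + 1 * √r → q₀ (0 - k) = 1 := by
  simpa only [zero_sub] using
    frequently_window_of_frequently_block Nat.frequently_even hq.even_block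

theorem IsAlternatingStart.frequently_eq_zero {q₀ : BddSeq} (hq : IsAlternatingStart q₀) :
    ∃ᶠ r : ℝ in atTop, ∀ k : ℕ, r ≤ k → k < r + 1 * √r → q₀ (0 - k) = 0 := by
  simpa only [zero_sub] using
    frequently_window_of_frequently_block Nat.frequently_odd hq.odd_block

end Pursuit

end CarChain

theorem mainTheorem7_general (q₀ : CarChain.BddSeq) (n : ℤ) {c : ℝ} (hc : 0 < c) {α β : ℝ}
    (hαβ : α ≠ β)
    (hα : ∃ᶠ r : ℝ in atTop, ∀ k : ℕ, r ≤ k → k < r + c * √r → q₀ (n - k) = α)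
    (hβ : ∃ᶠ r : ℝ in atTop, ∀ k : ℕ, r ≤ k → k < r + c * √r → q₀ (n - k) = β) :
    ¬ ∃ L : ℝ, Tendsto (fun t : ℝ => CarChain.pursuit q₀ t n) atTop (𝓝 L) := fun ⟨_, hL⟩ =>
  hαβ <| (CarChain.eq_of_tendsto_pursuit_of_frequently_eq hL hc hα).symm.trans
    (CarChain.eq_of_tendsto_pursuit_of_frequently_eq hL hc hβ)

theorem mainTheorem7 :
    (∃ q₀ : CarChain.BddSeq, CarChain.IsAlternatingStart q₀) ∧
      ∀ q₀ : CarChain.BddSeq, CarChain.IsAlternatingStart q₀ →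
        ¬ ∃ L : ℝ, Tendsto (fun t : ℝ => CarChain.pursuit q₀ t 0) atTop (𝓝 L) :=
  ⟨CarChain.exists_isAlternatingStart, fun q₀ hq => mainTheorem7_general q₀ 0 one_pos one_ne_zero
    hq.frequently_eq_one hq.frequently_eq_zero⟩
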